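/- Let $n\ge 0$, and let $M_1$, $M_2$ be closed (compact, without boundary), connected, orientable smooth $n$-manifolds with smooth Riemannian metrics $g_1$, $g_2$. For a closed connected orientable Riemannian $n$-manifold $(M,g)$ with Riemannian distance $d$, define the Lipschitz constant of $f:M\to M$ as $\operatorname{Lip}(f)=\sup_{u\neq v} d(f(u),f(v))/d(u,v)\in[0,+\infty]$ (a supremum over the empty set is $0$), let $\deg(f)\in\mathbb Z$ denote the mapping degree of a continuous map $f : M\to M$, i.e. $f_*[M]=\deg(f)\,[M]$ for a generator $[M]$ of $H_n(M;\mathbb Z)\cong\mathbb Z$, and define the flexible exponent $$\alpha(M)=\alpha(M,g)=\inf\{\alpha\ge 0 \mid \exists\, C>0 \text{ such that } |\deg(f)|\le C\cdot(\operatorname{Lip}(f))^{\alpha}\text{ for all Lipschitz maps } f:M\to M\},$$ with the convention $0^0=1$. If $M_1$ and $M_2$ are homotopy equivalent, then $\alpha(M_1,g_1)=\alpha(M_2,g_2)$. In particular, $\alpha(M)$ does not depend on the choice of the Riemannian metric: for any two Riemannian metrics $g,g'$ on a closed connected orientable smooth $n$-manifold $M$, $\alpha(M,g)=\alpha(M,g')$.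 -/

import Mathlib

open CategoryTheory Manifold Bundle ContinuousMap
open scoped ContDiff ENNReal NNReal

universe u

noncomputable section

namespace FlexibleExponent

/-- Singular homology `H_n(X; ℤ)` (the coefficient group `ℤ` is lifted to the universe of `X`). -/
abbrev integralHomology (n : ℕ) (X : Type u) [TopologicalSpace X] : ModuleCat.{u} ℤ :=
  ((AlgebraicTopology.singularHomologyFunctor (ModuleCat.{u} ℤ) n).obj
    (ModuleCat.of ℤ (ULift.{u} ℤ))).obj (TopCat.of X)

/-- The homomorphism `f_* : H_n(X; ℤ) → H_n(Y; ℤ)` induced by a continuous map. -/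
def integralHomologyMap (n : ℕ) {X Y : Type u} [TopologicalSpace X] [TopologicalSpace Y]
    (f : C(X, Y)) : integralHomology n X →ₗ[ℤ] integralHomology n Y :=
  (((AlgebraicTopology.singularHomologyFunctor (ModuleCat.{u} ℤ) n).obj
    (ModuleCat.of ℤ (ULift.{u} ℤ))).map (TopCat.ofHom f)).hom

/-- `z` is a fundamental class of the closed connected orientable `n`-manifold `M`: a generator of
the infinite cyclic group `H_n(M; ℤ)`. -/
def IsFundamentalClass (n : ℕ) {M : Type u} [TopologicalSpace M]
    (z : integralHomology n M) : Prop :=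
  Function.Bijective (fun k : ℤ => k • z)

/-- The self-map `f` of `M` has degree `d`: `f_*[M] = d [M]`. -/
def HasDegree (n : ℕ) {M : Type u} [TopologicalSpace M] (f : C(M, M)) (d : ℤ) : Prop :=
  ∃ z : integralHomology n M, IsFundamentalClass n z ∧ integralHomologyMap n f z = d • z

open Classical in
/-- The mapping degree of a self-map of a closed connected orientable `n`-manifold. The value `0`
is used only when `M` has no fundamental class. -/
def degree (n : ℕ) {M : Type u} [TopologicalSpace M] (f : C(M, M)) : ℤ :=
  if h : ∃ d : ℤ, HasDegree n f d then h.choose else 0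

/-- A smooth `n`-manifold is orientable if it is covered by charts of its smooth structure whose
transition maps all have positive Jacobian determinant. -/
def Orientable (n : ℕ) (M : Type u) [TopologicalSpace M]
    [ChartedSpace (EuclideanSpace ℝ (Fin n)) M] : Prop :=
  ∃ A : Set (OpenPartialHomeomorph M (EuclideanSpace ℝ (Fin n))),
    A ⊆ IsManifold.maximalAtlas (𝓡 n) ∞ M ∧
    (∀ x : M, ∃ φ ∈ A, x ∈ φ.source) ∧
    ∀ φ ∈ A, ∀ ψ ∈ A, ∀ x ∈ φ.source ∩ ψ.source,
      0 < (fderiv ℝ (fun y => ψ (φ.symm y)) (φ x)).det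

/-- Smooth Riemannian metrics on the smooth `n`-manifold `M`. -/
abbrev Metric (n : ℕ) (M : Type u) [TopologicalSpace M]
    [ChartedSpace (EuclideanSpace ℝ (Fin n)) M] [IsManifold (𝓡 n) ∞ M] : Type u :=
  ContMDiffRiemannianMetric (𝓡 n) ∞ (EuclideanSpace ℝ (Fin n))
    (fun x : M => TangentSpace (𝓡 n) x)

section

variable {n : ℕ} {M : Type u} [TopologicalSpace M]
    [ChartedSpace (EuclideanSpace ℝ (Fin n)) M] [IsManifold (𝓡 n) ∞ M]

/-- The Riemannian distance of `g`: the infimum of the `g`-lengths of `C^1` paths. -/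
def riemDist (g : Metric n M) (x y : M) : ℝ≥0∞ :=
  letI : RiemannianBundle (fun x : M => TangentSpace (𝓡 n) x) := ⟨g.toRiemannianMetric⟩
  riemannianEDist (𝓡 n) x y

/-- The Lipschitz constant of a self-map of `(M, g)`, in `[0, ∞]`. -/
def lip (g : Metric n M) (f : M → M) : ℝ≥0∞ :=
  ⨆ (u : M) (v : M) (_ : u ≠ v), riemDist g (f u) (f v) / riemDist g u v

/-- The exponents `a ≥ 0` for which there is `C > 0` with `|deg f| ≤ C (Lip f)^a` for all Lipschitz
maps `f : M → M`. -/
def admissibleExponents (g : Metric n M) : Set ℝ :=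
  {a : ℝ | 0 ≤ a ∧ ∃ C : ℝ, 0 < C ∧ ∀ f : C(M, M), lip g f < ⊤ →
    |(degree n f : ℝ)| ≤ C * (lip g f).toReal ^ a}

/-- The flexible exponent of the closed connected orientable Riemannian manifold `(M, g)`, with
the convention that the infimum of the empty set is `∞`. -/
def flexibleExponent (g : Metric n M) : ℝ≥0∞ :=
  ⨅ a ∈ admissibleExponents g, ENNReal.ofReal a

end

end FlexibleExponent

end

/-! ### Degrees and conjugation by a homotopy equivalence. -/

namespace FlexibleExponent

/-! Take mutually inverse homotopy equivalences h : M → N and k : N → M. Passing from f to h ∘ f ∘ k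
preserves the degree, since h and k induce inverse isomorphisms on homology (`degree_conj`). Up to
homotopy h and k are C^1 (`exists_homotopic_contMDiff`), hence Lipschitz by compactness
(`exists_riemannianEDist_le_mul`), so the conjugation multiplies Lip(f) by at most a fixed constant.
A bound |deg| ≤ K Lip^a on N thus yields one on M with the same exponent, and by symmetry the
admissible exponents coincide. Independence of the metric is the case of the identity equivalence.
-/

lemma integralHomologyMap_id (n : ℕ) (X : Type u) [TopologicalSpace X] :
    integralHomologyMap n (ContinuousMap.id X) = LinearMap.id := by
  unfold integralHomologyMap
  rw [TopCat.ofHom_id, CategoryTheory.Functor.map_id]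
  rfl

lemma integralHomologyMap_comp (n : ℕ) {X Y Z : Type u} [TopologicalSpace X]
    [TopologicalSpace Y] [TopologicalSpace Z] (g : C(Y, Z)) (f : C(X, Y)) :
    integralHomologyMap n (g.comp f) = integralHomologyMap n g ∘ₗ integralHomologyMap n f := by
  unfold integralHomologyMap
  rw [TopCat.ofHom_comp, CategoryTheory.Functor.map_comp]
  rfl

lemma integralHomologyMap_eq_of_homotopic (n : ℕ) {X Y : Type u} [TopologicalSpace X]
    [TopologicalSpace Y] {f g : C(X, Y)} (h : f.Homotopic g) :
    integralHomologyMap n f = integralHomologyMap n g := by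
  obtain ⟨H⟩ := h
  exact congrArg ModuleCat.Hom.hom
    (TopCat.Homotopy.congr_homologyMap_singularChainComplexFunctor
      (f := TopCat.ofHom f) (g := TopCat.ofHom g) H (ModuleCat.of ℤ (ULift.{u} ℤ)) n)

lemma HasDegree.unique {n : ℕ} {M : Type u} [TopologicalSpace M] {f : C(M, M)} {d e : ℤ}
    (hd : HasDegree n f d) (he : HasDegree n f e) : d = e := by
  obtain ⟨z, hz, hzd⟩ := hd
  obtain ⟨w, hw, hwe⟩ := he
  obtain ⟨k, rfl⟩ := hz.2 w
  have hwe' : (k * d) • z = (e * k) • z := by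
    have h : integralHomologyMap n f (k • z) = e • (k • z) := hwe
    rw [map_zsmul, hzd] at h
    rw [mul_smul, mul_smul, h]
  have h1 : k * d = e * k := hz.1 hwe'
  have hk : k ≠ 0 := by
    rintro rfl
    have : (1 : ℤ) = 0 := hw.1 (by simp)
    exact one_ne_zero this
  rw [mul_comm e k] at h1
  exact mul_left_cancel₀ hk h1

lemma degree_eq {n : ℕ} {M : Type u} [TopologicalSpace M] {f : C(M, M)} {d : ℤ}
    (hd : HasDegree n f d) : degree n f = d := by
  have h : ∃ d : ℤ, HasDegree n f d := ⟨d, hd⟩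
  rw [degree, dif_pos h]
  exact h.choose_spec.unique hd

lemma HasDegree.conj {n : ℕ} {M N : Type u} [TopologicalSpace M] [TopologicalSpace N]
    {h : C(M, N)} {k : C(N, M)} (hkh : (k.comp h).Homotopic (.id M))
    (hhk : (h.comp k).Homotopic (.id N)) {f : C(M, M)} {d : ℤ} (hd : HasDegree n f d) :
    HasDegree n (h.comp (f.comp k)) d := by
  obtain ⟨z, hz, hzd⟩ := hd
  have e₁ : integralHomologyMap n k ∘ₗ integralHomologyMap n h = LinearMap.id := by
    rw [← integralHomologyMap_comp, integralHomologyMap_eq_of_homotopic n hkh,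
      integralHomologyMap_id]
  have e₂ : integralHomologyMap n h ∘ₗ integralHomologyMap n k = LinearMap.id := by
    rw [← integralHomologyMap_comp, integralHomologyMap_eq_of_homotopic n hhk,
      integralHomologyMap_id]
  let e : integralHomology n M ≃ₗ[ℤ] integralHomology n N :=
    .ofLinearMap (integralHomologyMap n h) (integralHomologyMap n k) e₂ e₁
  refine ⟨integralHomologyMap n h z, ?_, ?_⟩
  · have : (fun m : ℤ => m • integralHomologyMap n h z) = e ∘ fun m : ℤ => m • z := by
      funext m
      exact (map_zsmul (integralHomologyMap n h) m z).symm
    rw [IsFundamentalClass, this]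
    exact e.bijective.comp hz
  · have hk : integralHomologyMap n k (integralHomologyMap n h z) = z := LinearMap.congr_fun e₁ z
    rw [integralHomologyMap_comp, integralHomologyMap_comp, LinearMap.comp_apply,
      LinearMap.comp_apply, hk, hzd, map_zsmul]

/-- The default value 0 causes no mismatch: conjugating back gives a map homotopic to `f`, so a
degree exists on one side exactly when it exists on the other. -/
lemma degree_conj (n : ℕ) {M N : Type u} [TopologicalSpace M] [TopologicalSpace N]
    {h : C(M, N)} {k : C(N, M)} (hkh : (k.comp h).Homotopic (.id M))
    (hhk : (h.comp k).Homotopic (.id N)) (f : C(M, M)) :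
    degree n (h.comp (f.comp k)) = degree n f := by
  by_cases hd : ∃ d, HasDegree n f d
  · obtain ⟨d, hd⟩ := hd
    rw [degree_eq hd, degree_eq (hd.conj hkh hhk)]
  · have hd' : ¬ ∃ d, HasDegree n (h.comp (f.comp k)) d := by
      rintro ⟨d, hd'⟩
      obtain ⟨z, hz, hzd⟩ := hd'.conj hhk hkh
      refine hd ⟨d, z, hz, ?_⟩
      have hom : (k.comp ((h.comp (f.comp k)).comp h)).Homotopic f := by
        have := hkh.comp ((Homotopic.refl f).comp hkh)
        exact this
      rwa [integralHomologyMap_eq_of_homotopic n hom] at hzd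
    rw [degree, dif_neg hd', degree, dif_neg hd]

/-! ### Homotoping continuous maps to C^1 maps. -/

section
open Set Filter Topology

variable {E H M E' H' N : Type*}
  [NormedAddCommGroup E] [NormedSpace ℝ E] [FiniteDimensional ℝ E]
  [TopologicalSpace H] {I : ModelWithCorners ℝ E H}
  [TopologicalSpace M] [ChartedSpace H M] [IsManifold I ∞ M] [CompactSpace M] [T2Space M]
  [NormedAddCommGroup E'] [NormedSpace ℝ E'] [FiniteDimensional ℝ E']
  [TopologicalSpace H'] {I' : ModelWithCorners ℝ E' H'} [I'.Boundaryless]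
  [TopologicalSpace N] [ChartedSpace H' N] [IsManifold I' ∞ N]

/-- A continuous map can be made `C^1` near a compact set that it sends into the domain of a chart,
by a homotopy which stays close to it and does not destroy differentiability elsewhere. -/
lemma exists_homotopic_contMDiffAt_of_mapsTo_source (f : C(M, N)) (y₀ : N) {K : Set M}
    (hK : IsClosed K) (hfK : MapsTo f K (extChartAt I' y₀).source) {O : Set (M × N)}
    (hO : IsOpen O) (hfO : ∀ x, (x, f x) ∈ O) :
    ∃ f' : C(M, N), f.Homotopic f' ∧ (∀ x, (x, f' x) ∈ O) ∧
      (∀ x, ContMDiffAt I I' 1 f x → ContMDiffAt I I' 1 f' x) ∧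
      ∀ x ∈ K, ContMDiffAt I I' 1 f' x := by
  set φ := extChartAt I' y₀ with hφ
  have hV : IsOpen (f ⁻¹' φ.source) := (isOpen_extChartAt_source y₀).preimage f.continuous
  obtain ⟨U, hU, hKU, hUV⟩ := normal_exists_closure_subset hK hV hfK
  have hT : IsClosed (closure U) := isClosed_closure
  -- a global continuous map which coincides with the reading of `f` in the chart on `closure U`
  have hφf : ContinuousOn (fun x => φ (f x)) (closure U) :=
    (continuousOn_extChartAt y₀).comp f.continuous.continuousOn hUV
  have : TietzeExtension.{_, _} E' := TietzeExtension.of_tvs ℝ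
  obtain ⟨F, hF⟩ := ContinuousMap.exists_restrict_eq hT ⟨_, hφf.domRestrict⟩
  replace hF : ∀ x ∈ closure U, F x = φ (f x) := fun x hx =>
    congrArg (fun G : C(closure U, E') => G ⟨x, hx⟩) hF
  have hFf : ∀ x ∈ closure U, φ.symm (F x) = f x := fun x hx => by
    rw [hF x hx, φ.left_inv (hUV hx)]
  -- uniform size of the allowed perturbations
  have htar : IsOpen φ.target := isOpen_extChartAt_target y₀
  have hcont : ContinuousOn (fun p : M × E' => (p.1, φ.symm (F p.1 + p.2)))
      ((fun p : M × E' => F p.1 + p.2) ⁻¹' φ.target) :=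
    continuousOn_fst.prodMk ((continuousOn_extChartAt_symm y₀).comp
      (by fun_prop) (fun p hp => hp))
  obtain ⟨u, v, hu, hv, hTu, h0v, huv⟩ := generalized_tube_lemma (s := closure U)
    (t := {(0 : E')}) hT.isCompact isCompact_singleton
    (hcont.isOpen_inter_preimage (htar.preimage (by fun_prop)) hO) (by
      rintro ⟨x, e⟩ ⟨hx, he⟩
      obtain rfl : e = 0 := he
      have hx : x ∈ closure U := hx
      refine ⟨?_, ?_⟩
      · change F x + 0 ∈ φ.target
        rw [add_zero, hF x hx]
        exact φ.map_source (hUV hx)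
      · change (x, φ.symm (F x + 0)) ∈ O
        rw [add_zero, hFf x hx]
        exact hfO x)
  obtain ⟨ε, hε, hεv⟩ := Metric.isOpen_iff.1 hv 0 (h0v rfl)
  obtain ⟨g, hg, -⟩ := F.continuous.exists_contMDiff_approx I 1 (ε := fun _ => ε)
    continuous_const (fun _ => hε)
  -- The cutoff is 1 near `K`, where the new map is read as the C^1 map `g`, and 0 near the
  -- complement of `U`, where the original map is unchanged.
  obtain ⟨χ, hχ0, hχ1, hχ⟩ := exists_contMDiffMap_zero_one_nhds_of_isClosed I (n := 1)
    hU.isClosed_compl hK (disjoint_compl_left_iff_subset.2 hKU)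
  have hχ0' : ∀ x ∉ U, ∀ᶠ z in 𝓝 x, χ z = 0 := fun x hx =>
    eventually_nhdsSet_iff_forall.1 hχ0 x hx
  -- the straight-line homotopy in the chart
  let P : ℝ → M → E' := fun t x => F x + (t * χ x) • (g x - F x)
  have hPmem : ∀ t ∈ Icc (0 : ℝ) 1, ∀ x ∈ closure U,
      P t x ∈ φ.target ∧ (x, φ.symm (P t x)) ∈ O := by
    intro t ht x hx
    refine huv (Set.mk_mem_prod (hTu hx) (hεv (a := (t * χ x) • (g x - F x)) ?_))
    rw [mem_ball_zero_iff, norm_smul]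
    have h1 : ‖t * χ x‖ ≤ 1 := by
      rw [Real.norm_eq_abs, abs_of_nonneg (mul_nonneg ht.1 (hχ x).1)]
      exact mul_le_one₀ ht.2 (hχ x).1 (hχ x).2
    have h2 : ‖g x - F x‖ < ε := by simpa [dist_eq_norm] using hg x
    nlinarith [norm_nonneg (g x - F x), norm_nonneg (t * χ x)]
  classical
  let G : ℝ → M → N := fun t x => if x ∈ U then φ.symm (P t x) else f x
  have hG_eq_f : ∀ x t, χ x = 0 → G t x = f x := by
    intro x t h
    by_cases hx : x ∈ U
    · simp only [G, P, hx, if_true, h, mul_zero, zero_smul, add_zero]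
      exact hFf x (subset_closure hx)
    · simp only [G, hx, if_false]
  have hGO : ∀ t ∈ Icc (0 : ℝ) 1, ∀ x, (x, G t x) ∈ O := by
    intro t ht x
    by_cases hx : x ∈ U
    · simpa only [G, hx, if_true] using (hPmem t ht x (subset_closure hx)).2
    · simpa only [G, hx, if_false] using hfO x
  have hGcont : Continuous (fun p : unitInterval × M => G p.1 p.2) := by
    rw [continuous_iff_continuousAt]
    rintro ⟨t, x⟩
    by_cases hx : x ∈ U
    · have h1 : ContinuousAt (fun p : unitInterval × M => φ.symm (P p.1 p.2)) (t, x) := by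
        have hP : Continuous (fun p : unitInterval × M => P p.1 p.2) := by
          have := χ.contMDiff.continuous
          have := g.contMDiff.continuous
          fun_prop
        exact ContinuousAt.comp (f := fun p : unitInterval × M => P p.1 p.2)
          ((continuousOn_extChartAt_symm y₀).continuousAt
          (htar.mem_nhds (hPmem t t.2 x (subset_closure hx)).1)) hP.continuousAt
      refine h1.congr ?_
      filter_upwards [continuousAt_snd.preimage_mem_nhds (hU.mem_nhds hx)] with p hp
      have hp : p.2 ∈ U := hp
      simp only [G, hp, if_true]
    -- Off `U`, including at its boundary, `χ` vanishes on a whole neighbourhood, so there both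
    -- branches of `G` equal `f`.
    · refine (f.continuous.comp continuous_snd).continuousAt.congr ?_
      filter_upwards [(continuous_snd.tendsto (t, x)).eventually (hχ0' x hx)] with p hp
      exact (hG_eq_f p.2 p.1 hp).symm
  have hG1 : Continuous (G 1) := hGcont.comp (Continuous.prodMk_right (1 : unitInterval))
  refine ⟨⟨G 1, hG1⟩, ⟨{ toFun := fun p => G p.1 p.2
                         continuous_toFun := hGcont
                         map_zero_left := fun x => ?_
                         map_one_left := fun x => rfl }⟩, hGO 1 (by simp), ?_, ?_⟩
  · change G 0 x = f x
    by_cases hx : x ∈ U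
    · simp only [G, P, hx, if_true, zero_mul, zero_smul, add_zero]
      exact hFf x (subset_closure hx)
    · simp only [G, hx, if_false]
  · intro x hfx
    by_cases hx : x ∈ U
    · have hFx : ContMDiffAt I 𝓘(ℝ, E') 1 F x := by
        have h1 : ContMDiffAt I 𝓘(ℝ, E') 1 (fun x => φ (f x)) x :=
          ((contMDiffAt_extChartAt' (n := 1) (by
            rw [← extChartAt_source I']; exact hUV (subset_closure hx))).comp x hfx)
        refine h1.congr_of_eventuallyEq ?_
        filter_upwards [hU.mem_nhds hx] with z hz using hF z (subset_closure hz)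
      have hPx : ContMDiffAt I 𝓘(ℝ, E') 1 (P 1) x :=
        hFx.add ((contMDiffAt_const.mul (χ.contMDiff x)).smul ((g.contMDiff x).sub hFx))
      have h2 : ContMDiffAt I I' 1 (fun z => φ.symm (P 1 z)) x :=
        ((contMDiffOn_extChartAt_symm (n := 1) y₀).contMDiffAt
          (htar.mem_nhds (hPmem 1 (by simp) x (subset_closure hx)).1)).comp x hPx
      refine h2.congr_of_eventuallyEq ?_
      filter_upwards [hU.mem_nhds hx] with z hz
      change G 1 z = _
      simp only [G, hz, if_true]
    · refine hfx.congr_of_eventuallyEq ?_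
      filter_upwards [hχ0' x hx] with z hz using hG_eq_f z 1 hz
  · intro x hx
    have hxU := hKU hx
    have hgP : ∀ z, χ z = 1 → P 1 z = g z := fun z hz => by simp [P, hz]
    have hχx := eventually_nhdsSet_iff_forall.1 hχ1 x hx
    have h2 : ContMDiffAt I I' 1 (fun z => φ.symm (g z)) x := by
      refine ((contMDiffOn_extChartAt_symm (n := 1) y₀).contMDiffAt
          (htar.mem_nhds ?_)).comp x (g.contMDiff x)
      rw [← hgP x hχx.self_of_nhds]
      exact (hPmem 1 (by simp) x (subset_closure hxU)).1
    refine h2.congr_of_eventuallyEq ?_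
    filter_upwards [hU.mem_nhds hxU, hχx] with z hz hz1
    change G 1 z = _
    simp only [G, hz, if_true, hgP z hz1]

variable (I I') in
/-- A continuous map from a compact manifold to a boundaryless manifold is homotopic to a `C^1`
map. -/
theorem exists_homotopic_contMDiff (f : C(M, N)) :
    ∃ f' : C(M, N), f.Homotopic f' ∧ ContMDiff I I' 1 f' := by
  have hloc : ∀ x : M, ∃ K ∈ 𝓝 x, IsClosed K ∧ MapsTo f K (extChartAt I' (f x)).source :=
    fun x => by
      obtain ⟨K, hK, hKc, hKs⟩ := exists_mem_nhds_isClosed_subset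
        (f.continuous.continuousAt.preimage_mem_nhds (extChartAt_source_mem_nhds (I := I') (f x)))
      exact ⟨K, hK, hKc, hKs⟩
  choose K hK hKc hKs using hloc
  obtain ⟨s, hs⟩ := CompactSpace.elim_nhds_subcover K hK
  -- A graph lies in `O` when its map sends every `K i` into the `i`-th chart. Being open, this
  -- condition can survive each correction, so the charts can be treated one by one.
  let O : Set (M × N) := ⋂ i ∈ s, ((K i)ᶜ ×ˢ univ) ∪ (univ ×ˢ (extChartAt I' (f i)).source)
  have hmem : ∀ x y, (x, y) ∈ O ↔ ∀ i ∈ s, x ∈ K i → y ∈ (extChartAt I' (f i)).source := by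
    intro x y
    simp only [O, mem_iInter, mem_union, mem_prod, mem_compl_iff, mem_univ, and_true, true_and]
    exact forall₂_congr fun i _ => by tauto
  have hO : IsOpen O := isOpen_biInter_finset fun i _ =>
    ((hKc i).isOpen_compl.prod isOpen_univ).union (isOpen_univ.prod (isOpen_extChartAt_source _))
  have key : ∀ t : Finset M, t ⊆ s → ∃ f' : C(M, N), f.Homotopic f' ∧ (∀ x, (x, f' x) ∈ O) ∧
      ∀ i ∈ t, ∀ x ∈ K i, ContMDiffAt I I' 1 f' x := by
    classical
    intro t
    induction t using Finset.induction_on with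
    | empty =>
      exact fun _ => ⟨f, .refl f, fun x => (hmem _ _).2 fun i _ hx => hKs i hx, by simp⟩
    | insert i t hi ih =>
      intro hts
      obtain ⟨f₁, hf₁, hf₁O, hf₁t⟩ := ih ((Finset.subset_insert i t).trans hts)
      obtain ⟨f₂, hf₂, hf₂O, hf₂s, hf₂K⟩ :=
        exists_homotopic_contMDiffAt_of_mapsTo_source (I := I) f₁ (f i) (hKc i)
          (fun x hx => (hmem _ _).1 (hf₁O x) i (hts (Finset.mem_insert_self i t)) hx) hO hf₁O
      refine ⟨f₂, hf₁.trans hf₂, hf₂O, fun j hj x hx => ?_⟩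
      rcases Finset.mem_insert.1 hj with rfl | hj
      · exact hf₂K x hx
      · exact hf₂s x (hf₁t j hj x hx)
  obtain ⟨f', hf', -, hsm⟩ := key s subset_rfl
  refine ⟨f', hf', fun x => ?_⟩
  have hx : x ∈ ⋃ i ∈ s, K i := hs ▸ mem_univ x
  simp only [mem_iUnion] at hx
  obtain ⟨i, hi, hx⟩ := hx
  exact hsm i hi x hx

end
-- Lipschitz bounds for C^1 maps and finiteness of the distance.
section
open Set Filter Topology MeasureTheory

variable {E H M E' H' N : Type*}
  [NormedAddCommGroup E] [NormedSpace ℝ E]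
  [TopologicalSpace H] {I : ModelWithCorners ℝ E H} [I.Boundaryless]
  [TopologicalSpace M] [ChartedSpace H M] [IsManifold I 1 M]
  [NormedAddCommGroup E'] [NormedSpace ℝ E']
  [TopologicalSpace H'] {I' : ModelWithCorners ℝ E' H'} [I'.Boundaryless]
  [TopologicalSpace N] [ChartedSpace H' N] [IsManifold I' 1 N]
  [RiemannianBundle (fun x : M => TangentSpace I x)]
  [IsContinuousRiemannianBundle E (fun x : M => TangentSpace I x)]
  [RiemannianBundle (fun x : N => TangentSpace I' x)]
  [IsContinuousRiemannianBundle E' (fun x : N => TangentSpace I' x)]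

attribute [local instance] normedAddCommGroupTangentSpaceVectorSpace
attribute [local instance] normedSpaceTangentSpaceVectorSpace

/-- The derivative of a `C^1` map between Riemannian manifolds is locally bounded. -/
lemma eventually_enorm_mfderiv_apply_le {h : M → N} {x : M} (hh : ContMDiffAt I I' 1 h x) :
    ∃ C : ℝ≥0, ∀ᶠ y in 𝓝 x, ∀ v : TangentSpace I y,
      ‖mfderiv I I' h y v‖ₑ ≤ C * ‖v‖ₑ := by
  obtain ⟨C₁, -, hC₁⟩ := eventually_enorm_mfderiv_extChartAt_lt I x
  obtain ⟨C₃, -, hC₃⟩ := eventually_enorm_mfderivWithin_symm_extChartAt_lt I' (h x)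
  set φ := extChartAt I x
  set φ' := extChartAt I' (h x)
  let ψ : E → E' := φ' ∘ h ∘ φ.symm
  have hψ : ContDiffAt ℝ 1 ψ (φ x) := by
    have := (contMDiffAt_iff.1 hh).2
    rw [I.range_eq_univ, contDiffWithinAt_univ] at this
    exact this
  have hψc : ContinuousAt (fun e => ‖fderiv ℝ ψ e‖₊) (φ x) :=
    (hψ.continuousAt_fderiv one_ne_zero).nnnorm
  obtain ⟨C₂, hC₂⟩ : ∃ C₂ : ℝ≥0, ∀ᶠ e in 𝓝 (φ x), ‖fderiv ℝ ψ e‖₊ < C₂ :=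
    ⟨‖fderiv ℝ ψ (φ x)‖₊ + 1, hψc.eventually_lt continuousAt_const (lt_add_one _)⟩
  have hψd : ∀ᶠ e in 𝓝 (φ x), DifferentiableAt ℝ ψ e :=
    (hψ.eventually (by simp)).mono fun e he => he.differentiableAt one_ne_zero
  have hφc : ContinuousAt φ x := continuousAt_extChartAt x
  have hφ'c : ContinuousAt (fun y => φ' (h y)) x :=
    (continuousAt_extChartAt (h x)).comp hh.continuousAt
  rw [I'.range_eq_univ, nhdsWithin_univ] at hC₃
  have hV : ∀ᶠ y in 𝓝 x, h y ∈ φ'.source :=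
    hh.continuousAt.eventually (extChartAt_source_mem_nhds (h x))
  refine ⟨C₃ * (C₂ * C₁), ?_⟩
  filter_upwards [hC₁, hφc.eventually hC₂, hφc.eventually hψd, hφ'c.eventually hC₃,
    hV.eventually_nhds, (extChartAt_source_mem_nhds (I := I) x)] with y h1 h2 hd h3 h4 hy v
  -- The chain rule bounds the derivative of `h` by the product of local bounds for a chart, the
  -- coordinate expression `ψ` and an inverse chart.
  have hev : h =ᶠ[𝓝 y] φ'.symm ∘ ψ ∘ φ := by
    filter_upwards [h4, (isOpen_extChartAt_source (I := I) x).mem_nhds hy] with z hz hz'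
    simp only [ψ, Function.comp_apply, φ.left_inv hz', φ'.left_inv hz]
  have hψy : ψ (φ y) = φ' (h y) := by simp only [ψ, Function.comp_apply, φ.left_inv hy]
  have hφd : MDifferentiableAt I 𝓘(ℝ, E) φ y :=
    mdifferentiableAt_extChartAt (by rwa [← extChartAt_source I])
  have hψd' : MDifferentiableAt 𝓘(ℝ, E) 𝓘(ℝ, E') ψ (φ y) := hd.mdifferentiableAt
  have hφ'd : MDifferentiableAt 𝓘(ℝ, E') I' φ'.symm (ψ (φ y)) := by
    have := mdifferentiableWithinAt_extChartAt_symm (I := I') (x := h x) (z := ψ (φ y))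
      (by rw [hψy]; exact φ'.map_source h4.self_of_nhds)
    rwa [I'.range_eq_univ, mdifferentiableWithinAt_univ] at this
  have hcomp : mfderiv I I' (φ'.symm ∘ ψ ∘ φ) y = (mfderiv 𝓘(ℝ, E') I' φ'.symm (ψ (φ y))) ∘L
      ((mfderiv 𝓘(ℝ, E) 𝓘(ℝ, E') ψ (φ y)) ∘L (mfderiv I 𝓘(ℝ, E) φ y)) := by
    rw [mfderiv_comp y hφ'd (hψd'.comp y hφd), mfderiv_comp y hψd' hφd]
    rfl
  have key : ‖mfderiv I I' (φ'.symm ∘ ψ ∘ φ) y v‖ₑ ≤ C₃ * (C₂ * (C₁ * ‖v‖ₑ)) := by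
    have h3' : ∀ e, e = φ' (h y) → ∀ w : E',
        ‖mfderiv 𝓘(ℝ, E') I' φ'.symm e w‖ₑ ≤ C₃ * ‖w‖ₑ := by
      rintro _ rfl w
      rw [mfderivWithin_univ] at h3
      exact (ContinuousLinearMap.le_opENorm (mfderiv 𝓘(ℝ, E') I' φ'.symm (φ' (h y))) w).trans
        (mul_le_mul_left h3.le _)
    have h2' : ∀ w : E, ‖fderiv ℝ ψ (φ y) w‖ₑ ≤ C₂ * ‖w‖ₑ := fun w =>
      (ContinuousLinearMap.le_opENorm (fderiv ℝ ψ (φ y)) w).trans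
        (mul_le_mul_left (ENNReal.coe_le_coe.2 h2.le) _)
    have h1' : ‖(show E from mfderiv I 𝓘(ℝ, E) φ y v)‖ₑ ≤ C₁ * ‖v‖ₑ :=
      (ContinuousLinearMap.le_opENorm (mfderiv I 𝓘(ℝ, E) φ y) v).trans
        (mul_le_mul_left h1.le _)
    rw [hcomp, mfderiv_eq_fderiv]
    exact (h3' _ hψy _).trans (mul_le_mul_right ((h2' _).trans (mul_le_mul_right h1' _)) _)
  -- The norm depends on the base point, and `h y` and `φ'.symm (ψ (φ y))` are only propositionally
  -- equal.
  have htransport : ∀ z w : N, z = w → ∀ e : E', ‖(show TangentSpace I' z from e)‖ₑ =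
      ‖(show TangentSpace I' w from e)‖ₑ := by
    rintro z _ rfl e
    rfl
  have h5 : ‖mfderiv I I' h y v‖ₑ = ‖mfderiv I I' (φ'.symm ∘ ψ ∘ φ) y v‖ₑ := by
    refine (htransport _ _ hev.self_of_nhds (mfderiv I I' h y v)).trans ?_
    exact congrArg (fun L : E →L[ℝ] E' =>
      ‖(show TangentSpace I' ((φ'.symm ∘ ψ ∘ φ) y) from L v)‖ₑ) hev.mfderiv_eq
  rw [h5]
  refine key.trans_eq ?_
  push_cast
  ring

variable (I I') in
/-- A `C^1` map on a compact Riemannian manifold is Lipschitz for the Riemannian distances. -/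
theorem exists_riemannianEDist_le_mul [CompactSpace M] {h : M → N} (hh : ContMDiff I I' 1 h) :
    ∃ C : ℝ≥0, 0 < C ∧ ∀ x y,
      riemannianEDist I' (h x) (h y) ≤ C * riemannianEDist I x y := by
  choose C hC using fun x => eventually_enorm_mfderiv_apply_le (hh x)
  obtain ⟨s, hs⟩ := CompactSpace.elim_nhds_subcover _ hC
  obtain ⟨D, hD⟩ : ∃ D : ℝ≥0, ∀ i ∈ s, C i ≤ D := ⟨s.sup C, fun i hi => Finset.le_sup hi⟩
  have hbound : ∀ (y : M) (v : TangentSpace I y),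
      ‖mfderiv I I' h y v‖ₑ ≤ (D + 1 : ℝ≥0) * ‖v‖ₑ := by
    intro y v
    have hy : y ∈ ⋃ x ∈ s, {y | ∀ v : TangentSpace I y, ‖mfderiv I I' h y v‖ₑ ≤ C x * ‖v‖ₑ} :=
      hs ▸ mem_univ y
    simp only [mem_iUnion] at hy
    obtain ⟨i, hi, hy⟩ := hy
    refine (hy v).trans (mul_le_mul_left (ENNReal.coe_le_coe.2 ?_) _)
    exact (hD i hi).trans (le_add_of_nonneg_right zero_le_one)
  -- `D` may be 0; adding 1 allows division by the constant. The bound is then tested on paths from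
  -- `x` to `y` of length below an arbitrary `r` exceeding their distance.
  refine ⟨D + 1, by positivity, fun x y => ?_⟩
  have hD0 : ((D + 1 : ℝ≥0) : ℝ≥0∞) ≠ 0 := ENNReal.coe_ne_zero.2 (by positivity)
  rw [mul_comm, ← ENNReal.div_le_iff hD0 ENNReal.coe_ne_top]
  refine le_of_forall_gt fun r hr => ?_
  obtain ⟨γ, hγ0, hγ1, hγ, hγr, -⟩ :=
    exists_lt_locally_constant_of_riemannianEDist_lt hr zero_lt_one
  refine lt_of_le_of_lt ?_ hγr
  rw [ENNReal.div_le_iff hD0 ENNReal.coe_ne_top, mul_comm]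
  refine (riemannianEDist_le_pathELength (γ := h ∘ γ) (hh.comp hγ).contMDiffOn
    (congrArg h hγ0) (congrArg h hγ1) zero_le_one).trans ?_
  rw [pathELength_eq_lintegral_mfderiv_Icc, pathELength_eq_lintegral_mfderiv_Icc,
    ← lintegral_const_mul' _ _ ENNReal.coe_ne_top]
  refine lintegral_mono fun t => ?_
  rw [mfderiv_comp t (hh.mdifferentiableAt one_ne_zero) (hγ.mdifferentiableAt one_ne_zero)]
  exact hbound (γ t) _

omit [I.Boundaryless] in
/-- In a connected Riemannian manifold, the Riemannian distance is finite. -/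
lemma riemannianEDist_lt_top [PreconnectedSpace M] (x y : M) : riemannianEDist I x y < ⊤ := by
  -- Every point has a neighbourhood at finite distance from it, so this set and its complement are
  -- both open.
  have hclopen : IsClopen {y | riemannianEDist I x y < ⊤} := by
    refine ⟨isOpen_compl_iff.1 (isOpen_iff_mem_nhds.2 fun z hz => ?_),
      isOpen_iff_mem_nhds.2 fun z hz => ?_⟩
    · filter_upwards [eventually_riemannianEDist_lt I z ENNReal.zero_lt_top] with w hw hw'
      refine hz (riemannianEDist_triangle.trans_lt (ENNReal.add_lt_top.2 ⟨hw', ?_⟩))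
      rwa [riemannianEDist_comm]
    · filter_upwards [eventually_riemannianEDist_lt I z ENNReal.zero_lt_top] with w hw
      exact riemannianEDist_triangle.trans_lt (ENNReal.add_lt_top.2 ⟨hz, hw⟩)
  have : y ∈ {y | riemannianEDist I x y < ⊤} := by
    rw [hclopen.eq_univ ⟨x, by simp [riemannianEDist_self]⟩]
    trivial
  exact this

end
-- Comparison of the admissible exponents.
section

variable {n : ℕ} {M : Type u} [TopologicalSpace M]
    [ChartedSpace (EuclideanSpace ℝ (Fin n)) M] [IsManifold (𝓡 n) ∞ M]
    {N : Type u} [TopologicalSpace N]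
    [ChartedSpace (EuclideanSpace ℝ (Fin n)) N] [IsManifold (𝓡 n) ∞ N]

instance isContinuousRiemannianBundle_metric (g : Metric n M) :
    letI : RiemannianBundle (fun x : M => TangentSpace (𝓡 n) x) := ⟨g.toRiemannianMetric⟩
    IsContinuousRiemannianBundle (EuclideanSpace ℝ (Fin n))
      (fun x : M => TangentSpace (𝓡 n) x) :=
  letI : RiemannianBundle (fun x : M => TangentSpace (𝓡 n) x) := ⟨g.toRiemannianMetric⟩
  ⟨g.inner, g.contMDiff.continuous, fun _ _ _ => rfl⟩

lemma riemDist_lt_top [ConnectedSpace M] (g : Metric n M) (x y : M) : riemDist g x y < ⊤ := by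
  let _ : RiemannianBundle (fun x : M => TangentSpace (𝓡 n) x) := ⟨g.toRiemannianMetric⟩
  have : IsManifold (𝓡 n) 1 M := IsManifold.of_le (n := ∞) (by simp)
  exact riemannianEDist_lt_top (I := 𝓡 n) x y

lemma riemDist_self (g : Metric n M) (x : M) : riemDist g x x = 0 := by
  let _ : RiemannianBundle (fun x : M => TangentSpace (𝓡 n) x) := ⟨g.toRiemannianMetric⟩
  exact riemannianEDist_self

lemma exists_riemDist_le_mul [CompactSpace M] (g : Metric n M) (g' : Metric n N) {h : M → N}
    (hh : ContMDiff (𝓡 n) (𝓡 n) 1 h) :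
    ∃ C : ℝ≥0, 0 < C ∧ ∀ x y, riemDist g' (h x) (h y) ≤ C * riemDist g x y := by
  let _ : RiemannianBundle (fun x : M => TangentSpace (𝓡 n) x) := ⟨g.toRiemannianMetric⟩
  let _ : RiemannianBundle (fun x : N => TangentSpace (𝓡 n) x) := ⟨g'.toRiemannianMetric⟩
  have : IsManifold (𝓡 n) 1 M := IsManifold.of_le (n := ∞) (by simp)
  have : IsManifold (𝓡 n) 1 N := IsManifold.of_le (n := ∞) (by simp)
  exact exists_riemannianEDist_le_mul (𝓡 n) (𝓡 n) hh

lemma riemDist_map_le_lip_mul [ConnectedSpace M] (g : Metric n M) {f : M → M}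
    (hf : lip g f < ⊤) (x y : M) : riemDist g (f x) (f y) ≤ lip g f * riemDist g x y := by
  by_cases hxy : x = y
  · subst hxy
    rw [riemDist_self]
    exact zero_le
  have hle : riemDist g (f x) (f y) / riemDist g x y ≤ lip g f :=
    le_iSup_of_le x (le_iSup_of_le y (le_iSup_of_le hxy le_rfl))
  -- Finiteness of Lip covers a zero denominator and connectedness excludes an infinite one;
  -- positivity of the distance is not needed.
  refine (ENNReal.div_le_iff_le_mul (Or.inr hf.ne) (Or.inl (riemDist_lt_top g x y).ne)).1 hle

lemma lip_conj_le [ConnectedSpace M] (g : Metric n M) (g' : Metric n N) {h : M → N} {k : N → M}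
    {C D : ℝ≥0} (hh : ∀ x y, riemDist g' (h x) (h y) ≤ C * riemDist g x y)
    (hk : ∀ x y, riemDist g (k x) (k y) ≤ D * riemDist g' x y) {f : M → M} (hf : lip g f < ⊤) :
    lip g' (fun x => h (f (k x))) ≤ (C * D : ℝ≥0) * lip g f := by
  refine iSup_le fun u => iSup_le fun v => iSup_le fun _ => ENNReal.div_le_of_le_mul ?_
  calc riemDist g' (h (f (k u))) (h (f (k v)))
      ≤ C * (lip g f * (D * riemDist g' u v)) := by
        refine (hh _ _).trans ?_
        gcongr
        refine (riemDist_map_le_lip_mul g hf _ _).trans ?_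
        gcongr
        exact hk u v
    _ = (C * D : ℝ≥0) * lip g f * riemDist g' u v := by
        push_cast
        ring

/-- An exponent which is admissible for `N` is admissible for any homotopy equivalent `M`. -/
lemma admissibleExponents_subset [ConnectedSpace M] [CompactSpace M] [T2Space M]
    [CompactSpace N] [T2Space N] (e : ContinuousMap.HomotopyEquiv M N)
    (g : Metric n M) (g' : Metric n N) :
    admissibleExponents g' ⊆ admissibleExponents g := by
  rintro a ⟨ha, K, hK, hbound⟩
  obtain ⟨h, heh, hh⟩ := exists_homotopic_contMDiff (𝓡 n) (𝓡 n) e.toFun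
  obtain ⟨k, hek, hk⟩ := exists_homotopic_contMDiff (𝓡 n) (𝓡 n) e.invFun
  obtain ⟨C, hC, hhC⟩ := exists_riemDist_le_mul g g' hh
  obtain ⟨D, hD, hkD⟩ := exists_riemDist_le_mul g' g hk
  have hkh : (k.comp h).Homotopic (.id M) := (hek.symm.comp heh.symm).trans e.left_inv
  have hhk : (h.comp k).Homotopic (.id N) := (heh.symm.comp hek.symm).trans e.right_inv
  have hCD : 0 < C * D := mul_pos hC hD
  -- The factor (CD)^a comes from Lip(h ∘ f ∘ k) ≤ CD · Lip(f).
  refine ⟨ha, K * ((C * D : ℝ≥0) : ℝ) ^ a, by positivity, fun f hf => ?_⟩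
  have hle : lip g' (h.comp (f.comp k)) ≤ (C * D : ℝ≥0) * lip g f := lip_conj_le g g' hhC hkD hf
  have htop : (C * D : ℝ≥0) * lip g f < ⊤ := ENNReal.mul_lt_top ENNReal.coe_lt_top hf
  have hreal : (lip g' (h.comp (f.comp k))).toReal ≤ ((C * D : ℝ≥0) : ℝ) * (lip g f).toReal := by
    simpa [ENNReal.toReal_mul] using ENNReal.toReal_mono htop.ne hle
  rw [← degree_conj n hkh hhk f]
  calc |(degree n (h.comp (f.comp k)) : ℝ)|
      ≤ K * (lip g' (h.comp (f.comp k))).toReal ^ a := hbound _ (hle.trans_lt htop)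
    _ ≤ K * (((C * D : ℝ≥0) : ℝ) * (lip g f).toReal) ^ a := by gcongr
    _ = K * ((C * D : ℝ≥0) : ℝ) ^ a * (lip g f).toReal ^ a := by
        rw [Real.mul_rpow (by positivity) (by positivity), mul_assoc]

theorem flexibleExponent_eq_of_homotopyEquiv [ConnectedSpace M] [CompactSpace M] [T2Space M]
    [ConnectedSpace N] [CompactSpace N] [T2Space N] (e : ContinuousMap.HomotopyEquiv M N)
    (g : Metric n M) (g' : Metric n N) : flexibleExponent g = flexibleExponent g' := by
  rw [flexibleExponent, flexibleExponent, (admissibleExponents_subset e g g').antisymm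
    (admissibleExponents_subset e.symm g' g)]

end
end FlexibleExponent
theorem lemma2p2 (n : ℕ)
    (M₁ : Type u) [TopologicalSpace M₁] [T2Space M₁] [CompactSpace M₁] [ConnectedSpace M₁]
    [ChartedSpace (EuclideanSpace ℝ (Fin n)) M₁] [IsManifold (𝓡 n) ∞ M₁]
    (hM₁ : FlexibleExponent.Orientable n M₁)
    (M₂ : Type u) [TopologicalSpace M₂] [T2Space M₂] [CompactSpace M₂] [ConnectedSpace M₂]
    [ChartedSpace (EuclideanSpace ℝ (Fin n)) M₂] [IsManifold (𝓡 n) ∞ M₂]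
    (hM₂ : FlexibleExponent.Orientable n M₂) :
    (Nonempty (ContinuousMap.HomotopyEquiv M₁ M₂) →
      ∀ (g₁ : FlexibleExponent.Metric n M₁) (g₂ : FlexibleExponent.Metric n M₂),
        FlexibleExponent.flexibleExponent g₁ = FlexibleExponent.flexibleExponent g₂) ∧
    (∀ g g' : FlexibleExponent.Metric n M₁,
      FlexibleExponent.flexibleExponent g = FlexibleExponent.flexibleExponent g') := by
  exact ⟨fun ⟨e⟩ g₁ g₂ => FlexibleExponent.flexibleExponent_eq_of_homotopyEquiv e g₁ g₂,
    fun g g' => FlexibleExponent.flexibleExponent_eq_of_homotopyEquiv (.refl M₁) g g'⟩
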